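/- Let $X$ be a Noetherian scheme. For a quasi-coherent sheaf $\mathcal M$ on $X$ let $\operatorname{Ass}(\mathcal M)$ be the set of points $x\in X$ for which there is $s\in\mathcal M_x$ with $\operatorname{ann}(s)=\mathfrak m_x$, the maximal ideal of $\mathcal O_{X,x}$. Let $\mathcal F$ be a non-zero coherent sheaf on $X$. Order $\operatorname{Ass}(\mathcal F)$ partially by: $\mathfrak q<\mathfrak p$ if $\overline{\{\mathfrak p\}}\subsetneq\overline{\{\mathfrak q\}}$. A coprimary filtration of $\mathcal F$ is a chain of coherent subsheaves $$0=\mathcal F^0\subseteq\mathcal F^1\subseteq\cdots\subseteq\mathcal F^n=\mathcal F$$ such that, for some total order on $\operatorname{Ass}(\mathcal F)$ extending this partial order, with $\operatorname{Ass}(\mathcal F)=\{\mathfrak p_1,\dots,\mathfrak p_n\}$, $\mathfrak p_1>\mathfrak p_2>\cdots>\mathfrak p_n$, one has $\operatorname{Ass}(\mathcal F^k/\mathcal F^{k-1})=\{\mathfrak p_k\}$ for all $1\le k\le n$. Let $0=\mathcal F^0\subseteq\cdots\subseteq\mathcal F^n=\mathcal F$ be a coprimary filtration of $\mathcal F$,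 let $2\le i\le n$, and let $\operatorname{Ass}(\mathcal F^i/\mathcal F^{i-1})=\{\mathfrak p\}$ and $\operatorname{Ass}(\mathcal F^{i-1}/\mathcal F^{i-2})=\{\mathfrak q\}$. Let $\iota:\operatorname{Spec}\mathcal O_{X,\mathfrak q}\to X$ be the canonical morphism and $\mathcal G^{i-1}=\ker(\mathcal F^i\to\iota_*\iota^*\mathcal F^i)$. Assume that $\overline{\{\mathfrak q\}}\not\subseteq\overline{\{\mathfrak p\}}$. Then $$0=\mathcal F^0\subseteq\cdots\subseteq\mathcal F^{i-2}\subseteq\mathcal G^{i-1}\subseteq\mathcal F^i\subseteq\cdots\subseteq\mathcal F^n=\mathcal F$$ is also a coprimary filtration of $\mathcal F$, and $\operatorname{Ass}(\mathcal F^i/\mathcal G^{i-1})=\{\mathfrak q\}$, $\operatorname{Ass}(\mathcal G^{i-1}/\mathcal F^{i-2})=\{\mathfrak p\}$. -/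

import Mathlib

open CategoryTheory CategoryTheory.Limits AlgebraicGeometry

universe u

noncomputable section

namespace CoprimaryFiltration

variable {X : Scheme.{u}}

/-- The stalk `M_x` of an `𝒪_X`-module is a module over the local ring `𝒪_{X,x}`
(Mathlib's structure on stalks of presheaves of modules). -/
instance stalkModule (M : X.Modules) (x : X) :
    Module (X.presheaf.stalk x) ↑(TopCat.Presheaf.stalk M.presheaf x) :=
  PresheafOfModules.instModuleCarrierStalkCommRingCatCarrierAbPresheafOpensCarrier
    (R := X.presheaf) M.val x

/-- The set `Ass(M)` of associated points: the points `x` for which some `s ∈ M_x` has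
annihilator equal to the maximal ideal of `𝒪_{X,x}`. -/
def assPoints (M : X.Modules) : Set X :=
  {x | ∃ s : ↑(TopCat.Presheaf.stalk M.presheaf x),
    Ideal.torsionOf (X.presheaf.stalk x) _ s = IsLocalRing.maximalIdeal (X.presheaf.stalk x)}

/-- Coherent sheaves on a (locally) Noetherian scheme: quasi-coherent `𝒪_X`-modules whose
sections over every affine open `U` form a finitely generated `Γ(X, U)`-module. -/
structure IsCoherent (M : X.Modules) : Prop where
  quasicoherent : M.IsQuasicoherent
  finite : ∀ U : X.Opens, IsAffineOpen U → Module.Finite Γ(X, U) Γ(M, U)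

/-- The subquotient `B / A` of `F`, for subsheaves `A ≤ B` of `F`. -/
def subquotient {F : X.Modules} (A B : Subobject F) (h : A ≤ B) : X.Modules :=
  cokernel (A.ofLE B h)

/-- The `i`-th graded piece (`i = 0, …, n - 1`) of a chain
`𝓕 0 ≤ 𝓕 1 ≤ ⋯ ≤ 𝓕 n` of subsheaves of `F`, namely `𝓕 (i + 1) / 𝓕 i`. -/
def gr {F : X.Modules} {n : ℕ} (𝓕 : Fin (n + 1) →o Subobject F) (i : Fin n) : X.Modules :=
  subquotient (𝓕 i.castSucc) (𝓕 i.succ) (𝓕.monotone (Fin.castSucc_le_succ i))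

/-- `r` is a (strict) total order on `Ass(F)` extending the partial order for which `q < p`
when the closure of `{p}` is strictly contained in the closure of `{q}`.
Here `r q p` is read as `q < p`. -/
structure IsLinearExtension (F : X.Modules) (r : assPoints F → assPoints F → Prop) : Prop where
  strictTotal : IsStrictTotalOrder (assPoints F) r
  extends_closure : ∀ p q : assPoints F, closure {(p : X)} ⊂ closure {(q : X)} → r q p

/-- The chain `𝓕 0 ≤ ⋯ ≤ 𝓕 n` is a coprimary filtration of `F`: it runs from `0` to `F`,
consists of coherent subsheaves, and for some total order on `Ass(F)` extending the
one by closures, listing `Ass(F)` decreasingly as `e 0 > e 1 > ⋯ > e (n - 1)`, one has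
`Ass(𝓕 (i + 1) / 𝓕 i) = {e i}` for all `i`. -/
structure IsCoprimaryFiltration {F : X.Modules} {n : ℕ}
    (𝓕 : Fin (n + 1) →o Subobject F) : Prop where
  eq_bot : 𝓕 0 = ⊥
  eq_top : 𝓕 (Fin.last n) = ⊤
  coherent : ∀ i, IsCoherent (𝓕 i : X.Modules)
  exists_order : ∃ r : assPoints F → assPoints F → Prop, IsLinearExtension F r ∧
    ∃ e : Fin n ≃ assPoints F, (∀ i j, i < j → r (e j) (e i)) ∧
      ∀ i, assPoints (gr 𝓕 i) = {(e i : X)}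

/-- For a subsheaf `A` of `F` and a point `q`, with canonical morphism
`f : Spec 𝒪_{X,q} ⟶ X`, the kernel of `A ⟶ f_* f^* A` (the unit of the adjunction between
pullback and pushforward), regarded as a subsheaf of `F`. -/
def kernelAt {F : X.Modules} (A : Subobject F) (q : X) : Subobject F :=
  (Subobject.map A.arrow).obj (kernelSubobject
    ((Scheme.Modules.pullbackPushforwardAdjunction (X.fromSpecStalk q)).unit.app (A : X.Modules)))

end CoprimaryFiltration

end

noncomputable section

namespace CoprimaryFiltration

open TopologicalSpace Opposite

variable {X : Scheme.{u}}

/-! Write A ⊆ B ⊆ C for the three consecutive terms with Ass(B/A) = {q} and Ass(C/B) = {p}, and K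
for the kernel of C → ι_*ι^*C.

The key fact is that C has zero stalk at every proper generization x of q. Over a Noetherian base, a
coherent quotient has zero stalk at x as soon as none of its associated points generizes x
(`stalkSub_le_of_forall_not_specializes`). None of the graded pieces below C has such a point: the
points before q in the list do not generize q because the list extends the closure order, q does not
generize a proper generization of itself, and p does not generize q by assumption. The same argument
gives A_q = 0.

Hence K consists of the sections of C whose germ at q vanishes (`mem_sectionSub_kernelAt_iff`), so
K_q = 0, K = C off the closure of q, and A ⊆ K. If x ≠ q lies in the closure of q, an f in 𝔪_x
invertible at q is injective on (C/K)_x, so Ass(C/K) ⊆ {q}; equality holds because (C/K)_q = C_q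
contains B_q = (B/A)_q. An associated point of K/A comes from C/B, or else from B/A, which would
force it to be q, where K vanishes; so Ass(K/A) ⊆ {p}. Equality follows because p ∈ Ass(F) must
occur in some graded piece, and it occurs in no other.

The new order exchanges the neighbours p and q. It still extends the closure order, since the only
comparison it reverses is excluded by the hypothesis on closures. -/

/-- The stalk of the `𝒪_X`-module `M` at `x`, as a type. -/
abbrev Stalk (M : X.Modules) (x : X) : Type u := ↑(TopCat.Presheaf.stalk M.presheaf x)

/-- The germ at `x` of a section of an `𝒪_X`-module, as an additive map. -/
abbrev germ (M : X.Modules) (U : X.Opens) (x : X) (hx : x ∈ U) : Γ(M, U) →+ Stalk M x :=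
  (TopCat.Presheaf.germ M.presheaf U x hx).hom

/-- Restriction of sections of an `𝒪_X`-module, as an additive map. -/
abbrev res (M : X.Modules) {U V : X.Opens} (h : U ≤ V) : Γ(M, V) →+ Γ(M, U) :=
  (M.presheaf.map (homOfLE h).op).hom

/-- Construct a morphism of `𝒪_X`-modules from compatible linear maps on sections. -/
def homMk {M N : X.Modules} (φ : ∀ U : X.Opens, Γ(M, U) →ₗ[Γ(X, U)] Γ(N, U))
    (hφ : ∀ (U V : X.Opens) (i : U ⟶ V) (s : Γ(M, V)),
      φ U (M.presheaf.map i.op s) = N.presheaf.map i.op (φ V s)) : M ⟶ N :=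
  ⟨{ app := fun U ↦ ModuleCat.ofHom (φ U.unop)
     naturality := fun {U V} i ↦ by
      ext s
      exact hφ _ _ i.unop s }⟩

lemma germ_smul (M : X.Modules) (x : X) (U : X.Opens) (hx : x ∈ U) (r : Γ(X, U)) (s : Γ(M, U)) :
    germ M U x hx (r • s) = X.presheaf.germ U x hx r • germ M U x hx s :=
  PresheafOfModules.germ_smul (R := X.presheaf) M.val x U hx r s

lemma germ_res (M : X.Modules) {U V : X.Opens} (h : U ≤ V) (x : X) (hx : x ∈ U) (s : Γ(M, V)) :
    germ M U x hx (res M h s) = germ M V x (h hx) s :=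
  TopCat.Presheaf.germ_res_apply M.presheaf (homOfLE h) x hx s

lemma res_smul (M : X.Modules) {U V : X.Opens} (h : U ≤ V) (r : Γ(X, V)) (s : Γ(M, V)) :
    res M h (r • s) = X.presheaf.map (homOfLE h).op r • res M h s :=
  M.map_smul (homOfLE h) r s

lemma res_res (M : X.Modules) {U V W : X.Opens} (h : U ≤ V) (h' : V ≤ W) (s : Γ(M, W)) :
    res M h (res M h' s) = res M (h.trans h') s := by
  exact (M.presheaf.map_comp_apply (homOfLE h').op (homOfLE h).op s).symm

lemma exists_germ_eq (M : X.Modules) {x : X} (t : Stalk M x) {V : X.Opens} (hV : x ∈ V) :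
    ∃ (U : X.Opens) (hU : x ∈ U) (_ : U ≤ V) (s : Γ(M, U)), germ M U x hU s = t := by
  obtain ⟨U, i, hU, s, hs⟩ := TopCat.Presheaf.exists_le_germ_eq M.presheaf t hV
  exact ⟨U, hU, i, s, hs⟩

lemma exists_res_eq_zero (M : X.Modules) {x : X} {U : X.Opens} (hU : x ∈ U) (s : Γ(M, U))
    (hs : germ M U x hU s = 0) : ∃ (V : X.Opens) (_ : x ∈ V) (h : V ≤ U), res M h s = 0 := by
  obtain ⟨W, hW, i, j, h⟩ := TopCat.Presheaf.germ_eq M.presheaf x hU hU s 0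
    (hs.trans (map_zero (germ M U x hU)).symm)
  exact ⟨W, hW, i.le, h.trans (map_zero (M.presheaf.map j.op).hom)⟩

lemma eq_zero_of_germ (M : X.Modules) {U : X.Opens} (s : Γ(M, U))
    (h : ∀ (x : X) (hx : x ∈ U), germ M U x hx s = 0) : s = 0 :=
  TopCat.Presheaf.section_ext ⟨M.presheaf, M.isSheaf⟩ U s 0
    fun x hx ↦ (h x hx).trans (map_zero (germ M U x hx)).symm

lemma app_res {M N : X.Modules} (φ : M ⟶ N) {U V : X.Opens} (h : U ≤ V) (s : Γ(M, V)) :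
    φ.app U (res M h s) = res N h (φ.app V s) :=
  congr($(φ.mapPresheaf.naturality (homOfLE h).op) s)

/-- The map induced on stalks by a morphism of `𝒪_X`-modules. -/
def stalkMap {M N : X.Modules} (φ : M ⟶ N) (x : X) :
    Stalk M x →ₗ[X.presheaf.stalk x] Stalk N x where
  toFun := (TopCat.Presheaf.stalkFunctor Ab x).map φ.mapPresheaf
  map_add' := map_add ((TopCat.Presheaf.stalkFunctor Ab x).map φ.mapPresheaf).hom
  map_smul' r t := by
    obtain ⟨V, hV, r, rfl⟩ := X.presheaf.exists_germ_eq r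
    obtain ⟨U, hU, hUV, t, rfl⟩ := exists_germ_eq M t hV
    rw [← TopCat.Presheaf.germ_res_apply X.presheaf (homOfLE hUV) x hU, ← germ_smul]
    refine (TopCat.Presheaf.stalkFunctor_map_germ_apply U x hU φ.mapPresheaf _).trans ?_
    refine (congrArg (germ N U x hU) (φ.app_smul _ _)).trans ?_
    refine (germ_smul _ _ _ _ _ _).trans ?_
    congr 1
    exact (TopCat.Presheaf.stalkFunctor_map_germ_apply U x hU φ.mapPresheaf _).symm

lemma stalkMap_germ {M N : X.Modules} (φ : M ⟶ N) (x : X) (U : X.Opens) (hx : x ∈ U) (s : Γ(M, U)) :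
    stalkMap φ x (germ M U x hx s) = germ N U x hx (φ.app U s) :=
  TopCat.Presheaf.stalkFunctor_map_germ_apply U x hx φ.mapPresheaf s

lemma stalkMap_comp {M N P : X.Modules} (φ : M ⟶ N) (ψ : N ⟶ P) (x : X) :
    stalkMap (φ ≫ ψ) x = stalkMap ψ x ∘ₗ stalkMap φ x := by
  ext t
  obtain ⟨U, hU, -, t, rfl⟩ := exists_germ_eq M t (V := ⊤) trivial
  simp only [LinearMap.comp_apply, stalkMap_germ]
  rfl

lemma app_injective {M N : X.Modules} (φ : M ⟶ N) [Mono φ] (U : X.Opens) :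
    Function.Injective (φ.app U) := by
  have : Mono φ.mapPresheaf := inferInstanceAs (Mono ((Scheme.Modules.toPresheaf X).map φ))
  have : Mono (φ.mapPresheaf.app (op U)) := inferInstance
  exact (AddCommGrpCat.mono_iff_injective _).mp this

lemma stalkMap_injective {M N : X.Modules} (φ : M ⟶ N) [Mono φ] (x : X) :
    Function.Injective (stalkMap φ x) :=
  TopCat.Presheaf.stalkFunctor_map_injective_of_app_injective
    (f := φ.mapPresheaf) (app_injective φ) x

/-! ### Skyscraper modules, used as test objects for stalks. -/

section Skyscraper

variable (x : X) (N : Type u) [AddCommGroup N]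

/-- Sections over `U` of the skyscraper sheaf at `x` with value `N`. -/
def SkySections {X : Scheme.{u}} (x : X) (N : Type u) (U : X.Opens) : Type u := PLift (x ∈ U) → N

instance (U : X.Opens) : AddCommGroup (SkySections x N U) :=
  inferInstanceAs (AddCommGroup (PLift (x ∈ U) → N))

/-- The skyscraper presheaf of abelian groups at `x` with value `N`. -/
def skyPresheaf {X : Scheme.{u}} (x : X) (N : Type u) [AddCommGroup N] :
    TopCat.Presheaf Ab.{u} X where
  obj U := AddCommGrpCat.of (SkySections x N U.unop)
  map i := AddCommGrpCat.ofHom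
    { toFun := fun (g : SkySections x N _) (h : PLift (x ∈ _)) ↦ g ⟨i.unop.le h.down⟩
      map_zero' := rfl
      map_add' := fun _ _ ↦ rfl }

lemma skyPresheaf_isSheaf : (skyPresheaf x N).IsSheaf := by
  rw [TopCat.Presheaf.isSheaf_iff_isSheaf_comp (forget Ab)]
  refine TopCat.Presheaf.isSheaf_of_isSheafUniqueGluing_types _ fun ι U sf hsf ↦ ?_
  have hsf' : ∀ i j (hi : x ∈ U i) (hj : x ∈ U j),
      (sf i : SkySections x N (U i)) ⟨hi⟩ = (sf j : SkySections x N (U j)) ⟨hj⟩ :=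
    fun i j hi hj ↦ congr_fun (hsf i j : (_ : SkySections x N (U i ⊓ U j)) = _) ⟨hi, hj⟩
  choose index index_spec using fun h : x ∈ iSup U ↦ Opens.mem_iSup.mp h
  refine ⟨show SkySections x N (iSup U) from fun h ↦
    (sf (index h.down) : SkySections x N _) ⟨index_spec h.down⟩, fun i ↦ ?_, fun t ht ↦ ?_⟩
  · exact funext fun h : PLift (x ∈ U i) ↦ hsf' _ _ _ _
  · exact funext fun h : PLift (x ∈ iSup U) ↦ congr_fun
      (ht (index h.down) : (_ : SkySections x N (U (index h.down))) = _) ⟨index_spec h.down⟩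

variable [Module (X.presheaf.stalk x) N]

instance (U : X.Opens) : Module Γ(X, U) (SkySections x N U) where
  smul r g := fun h ↦ X.presheaf.germ U x h.down r • (g h : N)
  one_smul g := funext fun h ↦ by
    change X.presheaf.germ U x h.down 1 • g h = g h
    rw [map_one, one_smul]
  mul_smul r r' g := funext fun h ↦ by
    change X.presheaf.germ U x h.down (r * r') • (g h : N) =
      X.presheaf.germ U x h.down r • X.presheaf.germ U x h.down r' • (g h : N)
    rw [map_mul, mul_smul]
  smul_zero r := funext fun h ↦ smul_zero (X.presheaf.germ U x h.down r)
  smul_add r g g' := funext fun h ↦ smul_add (X.presheaf.germ U x h.down r) (g h) (g' h)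
  add_smul r r' g := funext fun h ↦ by
    change X.presheaf.germ U x h.down (r + r') • (g h : N) =
      X.presheaf.germ U x h.down r • (g h : N) + X.presheaf.germ U x h.down r' • (g h : N)
    rw [map_add, add_smul]
  zero_smul g := funext fun h ↦ by
    change X.presheaf.germ U x h.down 0 • g h = 0
    rw [map_zero, zero_smul]

instance (U : X.Opensᵒᵖ) :
    Module ((X.presheaf ⋙ forget₂ CommRingCat RingCat).obj U) ((skyPresheaf x N).obj U) :=
  inferInstanceAs (Module Γ(X, U.unop) (SkySections x N U.unop))

/-- The skyscraper `𝒪_X`-module at `x` attached to a module over the local ring at `x`. -/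
def skyscraper : X.Modules where
  val := PresheafOfModules.ofPresheaf (R := X.presheaf ⋙ forget₂ CommRingCat RingCat)
    (skyPresheaf x N) fun U V i r g ↦ funext fun h : PLift (x ∈ V.unop) ↦ by
      change X.presheaf.germ U.unop x _ r • (g : SkySections x N U.unop) _ =
        X.presheaf.germ V.unop x h.down (X.presheaf.map i r) • (g : SkySections x N U.unop) _
      congr 1
      exact (TopCat.Presheaf.germ_res_apply X.presheaf i.unop x h.down r).symm
  isSheaf := skyPresheaf_isSheaf x N

variable {x N}

/-- A linear map out of the stalk at `x` gives a morphism to the skyscraper module. -/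
def toSkyscraper {M : X.Modules} (g : Stalk M x →ₗ[X.presheaf.stalk x] N) :
    M ⟶ skyscraper x N :=
  homMk (fun U ↦
    { toFun := fun s ↦ show SkySections x N U from fun h ↦ g (germ M U x h.down s)
      map_add' := fun s t ↦ funext fun h : PLift (x ∈ U) ↦
        (congrArg g (map_add (germ M U x h.down) s t)).trans (map_add g _ _)
      map_smul' := fun r s ↦ funext fun h : PLift (x ∈ U) ↦
        (congrArg g (germ_smul M x U h.down r s)).trans (map_smul g _ _) })
    fun U _ i s ↦ funext fun h : PLift (x ∈ U) ↦ congrArg g (germ_res M i.le x h.down s)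

end Skyscraper

/-! ### Exactness of stalks and left exactness of sections. -/

/-- The quotient of N_x by the image of M_x defines a map from N to a skyscraper. It vanishes on M,
hence is zero because φ is epi, so the quotient is trivial. -/
lemma stalkMap_surjective {M N : X.Modules} (φ : M ⟶ N) [Epi φ] (x : X) :
    Function.Surjective (stalkMap φ x) := by
  have h : toSkyscraper (LinearMap.range (stalkMap φ x)).mkQ = 0 := by
    rw [← cancel_epi φ, comp_zero]
    ext U s
    refine funext fun h : PLift (x ∈ U) ↦ ?_
    exact (Submodule.Quotient.mk_eq_zero _).mpr ⟨_, stalkMap_germ φ x U h.down s⟩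
  intro t
  obtain ⟨U, hU, -, t, rfl⟩ := exists_germ_eq N t (V := ⊤) trivial
  have := congr_fun (congr($(h).app U t) :
    (_ : SkySections x (_ ⧸ LinearMap.range (stalkMap φ x)) U) = _) ⟨hU⟩
  exact (Submodule.Quotient.mk_eq_zero _).mp this

/-- The map from N to the skyscraper on N_x / im M_x kills M, so it factors through the cokernel; a
germ that dies in the cokernel therefore dies in N_x / im M_x. -/
lemma ker_stalkMap_cokernel {M N : X.Modules} (φ : M ⟶ N) (x : X) :
    LinearMap.ker (stalkMap (cokernel.π φ) x) = LinearMap.range (stalkMap φ x) := by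
  refine le_antisymm (fun t ht ↦ ?_) ?_
  · let g : N ⟶ skyscraper x _ := toSkyscraper (LinearMap.range (stalkMap φ x)).mkQ
    have hg : φ ≫ g = 0 := by
      ext U s
      refine funext fun h : PLift (x ∈ U) ↦ ?_
      exact (Submodule.Quotient.mk_eq_zero _).mpr ⟨_, stalkMap_germ φ x U h.down s⟩
    obtain ⟨U, hU, -, t, rfl⟩ := exists_germ_eq N t (V := ⊤) trivial
    rw [LinearMap.mem_ker, stalkMap_germ] at ht
    obtain ⟨V, hV, hVU, h⟩ := exists_res_eq_zero _ _ _ ht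
    rw [← app_res] at h
    have h' : g.app V (res N hVU t) = 0 := by
      rw [← cokernel.π_desc φ g hg]
      change (cokernel.desc φ g hg).app V ((cokernel.π φ).app V _) = 0
      rw [h, map_zero]
    have h'' := congr_fun (h' : (_ : SkySections x (_ ⧸ LinearMap.range (stalkMap φ x)) V) = _) ⟨hV⟩
    rw [← germ_res N hVU x hV]
    exact (Submodule.Quotient.mk_eq_zero _).mp h''
  · rintro _ ⟨t, rfl⟩
    obtain ⟨U, hU, -, t, rfl⟩ := exists_germ_eq M t (V := ⊤) trivial
    rw [LinearMap.mem_ker, stalkMap_germ, stalkMap_germ]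
    have h : (φ ≫ cokernel.π φ).app U t = 0 := by rw [cokernel.condition]; rfl
    exact (congrArg _ h).trans (map_zero _)

/-- Taking sections over U preserves limits, in particular kernels. -/
lemma exists_of_app_eq_zero {M N P : X.Modules} {φ : M ⟶ N} {ψ : N ⟶ P} (w : φ ≫ ψ = 0)
    (h : IsLimit (KernelFork.ofι φ w)) {U : X.Opens} (s : Γ(N, U)) (hs : ψ.app U s = 0) :
    ∃ a : Γ(M, U), φ.app U a = s := by
  let G : X.Modules ⥤ Ab := Scheme.Modules.toPresheaf X ⋙ (evaluation _ _).obj (op U)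
  have : PreservesLimitsOfSize.{u, u} G :=
    have : PreservesLimits ((evaluation (Opens X)ᵒᵖ Ab.{u}).obj (op U)) := inferInstance
    comp_preservesLimits _ _
  have : PreservesLimitsOfSize.{0, 0} G := preservesLimitsOfSize_shrink.{0, u, 0, u} G
  have : G.PreservesZeroMorphisms := ⟨fun _ _ ↦ rfl⟩
  have hG := KernelFork.mapIsLimit _ h G
  have hG' := ShortComplex.exact_of_f_is_kernel (ShortComplex.mk (G.map φ) (G.map ψ)
    (by rw [← G.map_comp, w, G.map_zero])) hG
  exact (ShortComplex.ab_exact_iff _).mp hG' s hs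

lemma comp_app_eq_zero {M N P : X.Modules} (φ : M ⟶ N) (ψ : N ⟶ P) {U : X.Opens} {s : Γ(M, U)}
    (hs : φ.app U s = 0) : (φ ≫ ψ).app U s = 0 :=
  (congrArg (ψ.app U) hs).trans (map_zero (ψ.app U).hom)

/-! ### Subsheaves as submodules of stalks and of sections; associated points. -/

variable {F : X.Modules}

/-- The submodule of the stalk of `F` at `x` given by a subsheaf of `F`. -/
def stalkSub (A : Subobject F) (x : X) : Submodule (X.presheaf.stalk x) (Stalk F x) :=
  LinearMap.range (stalkMap A.arrow x)

/-- The submodule of the sections of `F` over `U` given by a subsheaf of `F`. -/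
def sectionSub (A : Subobject F) (U : X.Opens) : Submodule Γ(X, U) Γ(F, U) where
  carrier := Set.range (A.arrow.app U)
  zero_mem' := ⟨0, map_zero (A.arrow.app U).hom⟩
  add_mem' := by
    rintro _ _ ⟨a, rfl⟩ ⟨b, rfl⟩
    exact ⟨a + b, map_add (A.arrow.app U).hom a b⟩
  smul_mem' := by
    rintro r _ ⟨a, rfl⟩
    exact ⟨r • a, A.arrow.app_smul r a⟩

lemma mem_sectionSub {A : Subobject F} {U : X.Opens} {s : Γ(F, U)} :
    s ∈ sectionSub A U ↔ ∃ a, A.arrow.app U a = s := Iff.rfl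

lemma mem_sectionSub_mk {M : X.Modules} (f : M ⟶ F) [Mono f] {U : X.Opens} {s : Γ(F, U)} :
    s ∈ sectionSub (Subobject.mk f) U ↔ ∃ a, f.app U a = s := by
  rw [mem_sectionSub]
  constructor
  · rintro ⟨a, rfl⟩
    refine ⟨(Subobject.underlyingIso f).hom.app U a, ?_⟩
    exact congr(($(Subobject.underlyingIso_hom_comp_eq_mk f)).app U a)
  · rintro ⟨a, rfl⟩
    refine ⟨(Subobject.underlyingIso f).inv.app U a, ?_⟩
    exact congr(($(Subobject.underlyingIso_arrow f)).app U a)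

lemma germ_mem_stalkSub (A : Subobject F) {U : X.Opens} {s : Γ(F, U)} (hs : s ∈ sectionSub A U)
    (x : X) (hx : x ∈ U) : germ F U x hx s ∈ stalkSub A x := by
  obtain ⟨a, rfl⟩ := hs
  exact ⟨_, stalkMap_germ _ _ _ _ _⟩

lemma exists_of_mem_stalkSub (A : Subobject F) {x : X} {t : Stalk F x} (ht : t ∈ stalkSub A x)
    {V : X.Opens} (hV : x ∈ V) : ∃ (U : X.Opens) (hU : x ∈ U) (_ : U ≤ V) (s : Γ(F, U)),
      s ∈ sectionSub A U ∧ germ F U x hU s = t := by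
  obtain ⟨t, rfl⟩ := ht
  obtain ⟨U, hU, hUV, a, rfl⟩ := exists_germ_eq _ t hV
  exact ⟨U, hU, hUV, _, ⟨a, rfl⟩, (stalkMap_germ _ _ _ _ _).symm⟩

lemma mem_stalkSub_iff_stalkMap_cokernel (A : Subobject F) {x : X} (t : Stalk F x) :
    t ∈ stalkSub A x ↔ stalkMap (cokernel.π A.arrow) x t = 0 := by
  rw [stalkSub, ← ker_stalkMap_cokernel, LinearMap.mem_ker]

/-- A subsheaf is the kernel of F → F/A, and vanishing of a section of F/A is tested on stalks. -/
lemma mem_sectionSub_iff (A : Subobject F) {U : X.Opens} (s : Γ(F, U)) :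
    s ∈ sectionSub A U ↔ ∀ (x : X) (hx : x ∈ U), germ F U x hx s ∈ stalkSub A x := by
  refine ⟨fun hs x hx ↦ germ_mem_stalkSub A hs x hx, fun h ↦ ?_⟩
  refine exists_of_app_eq_zero (cokernel.condition _) (Abelian.monoIsKernelOfCokernel
    (Cofork.ofπ (cokernel.π A.arrow) _) (cokernelIsCokernel A.arrow)) s
    (eq_zero_of_germ _ _ fun x hx ↦ ?_)
  rw [← stalkMap_germ, ← mem_stalkSub_iff_stalkMap_cokernel]
  exact h x hx

lemma le_iff_stalkSub_le {A B : Subobject F} : A ≤ B ↔ ∀ x, stalkSub A x ≤ stalkSub B x := by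
  constructor
  · rintro h x _ ⟨t, rfl⟩
    refine ⟨stalkMap (A.ofLE B h) x t, ?_⟩
    rw [← LinearMap.comp_apply, ← stalkMap_comp, Subobject.ofLE_arrow]
  · intro h
    have h0 : A.arrow ≫ cokernel.π B.arrow = 0 := by
      ext U a
      refine eq_zero_of_germ _ _ fun x hx ↦ ?_
      change germ _ _ _ _ ((cokernel.π B.arrow).app U (A.arrow.app U a)) = 0
      rw [← stalkMap_germ, ← mem_stalkSub_iff_stalkMap_cokernel]
      exact h x (germ_mem_stalkSub A ⟨a, rfl⟩ x hx)
    exact Subobject.le_of_comm (Abelian.monoLift B.arrow A.arrow h0)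
      (Abelian.monoLift_comp _ _ _)

lemma stalkSub_bot (x : X) : stalkSub (⊥ : Subobject F) x = ⊥ := by
  refine le_bot_iff.mp ?_
  rintro _ ⟨t, rfl⟩
  obtain ⟨U, hU, -, a, rfl⟩ := exists_germ_eq _ t (V := ⊤) trivial
  rw [Submodule.mem_bot, stalkMap_germ, Subobject.bot_arrow]
  exact map_zero (germ F U x hU)

lemma stalkSub_top (x : X) : stalkSub (⊤ : Subobject F) x = ⊤ :=
  LinearMap.range_eq_top.mpr (stalkMap_surjective _ x)

lemma mem_assPoints_iff (M : X.Modules) (x : X) :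
    x ∈ assPoints M ↔ ∃ t : Stalk M x, ∀ r : X.presheaf.stalk x,
      r • t = 0 ↔ r ∈ IsLocalRing.maximalIdeal (X.presheaf.stalk x) := by
  refine exists_congr fun t ↦ ?_
  rw [SetLike.ext_iff]
  exact forall_congr' fun r ↦ by rw [Ideal.mem_torsionOf_iff]

lemma mem_assPoints_subquotient {A B : Subobject F} (h : A ≤ B) (x : X) :
    x ∈ assPoints (subquotient A B h) ↔ ∃ t ∈ stalkSub B x, ∀ r : X.presheaf.stalk x,
      r • t ∈ stalkSub A x ↔ r ∈ IsLocalRing.maximalIdeal (X.presheaf.stalk x) := by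
  have key (b : Stalk (B : X.Modules) x) :
      stalkMap (cokernel.π (A.ofLE B h)) x b = 0 ↔ stalkMap B.arrow x b ∈ stalkSub A x := by
    rw [← LinearMap.mem_ker, ker_stalkMap_cokernel, stalkSub, ← Subobject.ofLE_arrow h,
      stalkMap_comp, LinearMap.range_comp]
    exact ⟨fun hb ↦ ⟨b, hb, rfl⟩, fun ⟨_, hb, e⟩ ↦ stalkMap_injective B.arrow x e ▸ hb⟩
  rw [mem_assPoints_iff]
  constructor
  · rintro ⟨t, ht⟩
    obtain ⟨b, rfl⟩ := stalkMap_surjective (cokernel.π (A.ofLE B h)) x t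
    refine ⟨_, ⟨b, rfl⟩, fun r ↦ ?_⟩
    have e := key (r • b)
    rw [map_smul, map_smul] at e
    exact e.symm.trans (ht r)
  · rintro ⟨_, ⟨b, rfl⟩, ht⟩
    refine ⟨stalkMap (cokernel.π (A.ofLE B h)) x b, fun r ↦ ?_⟩
    have e := key (r • b)
    rw [map_smul, map_smul] at e
    exact e.trans (ht r)

/-! ### The kernel of localization at a point. -/

/-- The unit `C ⟶ f_* f^* C` for `f : Spec 𝒪_{X,q} ⟶ X`. -/
abbrev localizationUnit (C : X.Modules) (q : X) :=
  (Scheme.Modules.pullbackPushforwardAdjunction (X.fromSpecStalk q)).unit.app C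

/-- The image of Spec 𝒪_{X,q} is the set of generizations of q, so the germs of the pulled-back
section are controlled by germs of s at those points. -/
lemma localizationUnit_app_eq_zero (C : X.Modules) (q : X) {U : X.Opens} (s : Γ(C, U))
    (h : ∀ (x : X) (hx : x ∈ U), x ⤳ q → germ C U x hx s = 0) :
    (localizationUnit C q).app U s = 0 := by
  refine eq_zero_of_germ ((Scheme.Modules.pullback (X.fromSpecStalk q)).obj C)
    (U := X.fromSpecStalk q ⁻¹ᵁ U) _ fun y hy ↦ ?_
  have hyq : X.fromSpecStalk q y ⤳ q := by
    have := Set.mem_range_self (f := X.fromSpecStalk q) y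
    rwa [Scheme.range_fromSpecStalk] at this
  obtain ⟨V, hV, hVU, hs⟩ := exists_res_eq_zero _ _ _ (h _ hy hyq)
  have h1 : (localizationUnit C q).app V (res C hVU s) = _ := app_res (localizationUnit C q) hVU s
  rw [hs, map_zero] at h1
  refine (germ_res ((Scheme.Modules.pullback (X.fromSpecStalk q)).obj C)
    (show X.fromSpecStalk q ⁻¹ᵁ V ≤ X.fromSpecStalk q ⁻¹ᵁ U from
      fun z hz ↦ hVU hz) y hV _).symm.trans ?_
  exact (congrArg (germ ((Scheme.Modules.pullback (X.fromSpecStalk q)).obj C)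
    (X.fromSpecStalk q ⁻¹ᵁ V) y hV) h1.symm).trans (map_zero _)

/-- The stalk of `C` at `q` as a module over the local ring of `Spec 𝒪_{X,q}` at its
closed point. -/
abbrev closedPointModule (C : X.Modules) (q : X) :
    Module ((Spec (X.presheaf.stalk q)).presheaf.stalk
      (IsLocalRing.closedPoint (X.presheaf.stalk q))) (Stalk C q) :=
  Module.compHom _ (stalkClosedPointIso (X.presheaf.stalk q)).hom.hom

attribute [local instance] closedPointModule in
/-- The canonical map from `C` to the pushforward of the skyscraper module with value `C_q`
at the closed point of `Spec 𝒪_{X,q}`. -/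
def toPushforwardSkyscraper (C : X.Modules) (q : X) :
    C ⟶ (Scheme.Modules.pushforward (X.fromSpecStalk q)).obj
      (skyscraper (IsLocalRing.closedPoint (X.presheaf.stalk q)) (Stalk C q)) :=
  have hq {U : X.Opens} (h : IsLocalRing.closedPoint (X.presheaf.stalk q) ∈
      X.fromSpecStalk q ⁻¹ᵁ U) : q ∈ U :=
    (Scheme.fromSpecStalk_closedPoint (x := q)) ▸
      (show X.fromSpecStalk q (IsLocalRing.closedPoint (X.presheaf.stalk q)) ∈ U from h)
  homMk (fun U ↦
    { toFun := fun s ↦ show SkySections _ (Stalk C q) (X.fromSpecStalk q ⁻¹ᵁ U) from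
        fun h ↦ germ C U q (hq h.down) s
      map_add' := fun s t ↦ funext fun h : PLift (_ ∈ X.fromSpecStalk q ⁻¹ᵁ U) ↦
        map_add (germ C U q (hq h.down)) s t
      map_smul' := fun r s ↦ funext fun h : PLift (_ ∈ X.fromSpecStalk q ⁻¹ᵁ U) ↦ by
        refine (germ_smul C q U (hq h.down) r s).trans ?_
        change _ = ((stalkClosedPointIso (X.presheaf.stalk q)).hom.hom
          ((Spec (X.presheaf.stalk q)).presheaf.germ _ _ h.down
            ((X.fromSpecStalk q).app U r))) • germ C U q (hq h.down) s
        congr 1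
        rw [Scheme.fromSpecStalk_app (hq h.down)]
        have h1 := TopCat.Presheaf.germ_res_apply (Spec (X.presheaf.stalk q)).presheaf
          (homOfLE le_top : X.fromSpecStalk q ⁻¹ᵁ U ⟶ ⊤) _ h.down
          ((Scheme.ΓSpecIso (X.presheaf.stalk q)).inv (X.presheaf.germ U q (hq h.down) r))
        have h2 := congr($(germ_stalkClosedPointIso_hom (X.presheaf.stalk q))
          ((Scheme.ΓSpecIso (X.presheaf.stalk q)).inv (X.presheaf.germ U q (hq h.down) r)))
        refine Eq.trans ?_ (h2.symm.trans (congrArg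
          (stalkClosedPointIso (X.presheaf.stalk q)).hom.hom h1.symm))
        exact congr($((Scheme.ΓSpecIso (X.presheaf.stalk q)).inv_hom_id.symm)
          (X.presheaf.germ U q (hq h.down) r)) })
    fun U _ i s ↦ funext fun h : PLift (_ ∈ X.fromSpecStalk q ⁻¹ᵁ U) ↦
      germ_res C i.le q (hq h.down) s

/-- By adjunction, the map from C to the pushed-forward skyscraper with value C_q factors through
the unit, and this map records the germ at q. No description of the stalks of the pullback is
needed. -/
lemma germ_eq_zero_of_localizationUnit (C : X.Modules) (q : X) {U : X.Opens} (hU : q ∈ U)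
    (s : Γ(C, U)) (hs : (localizationUnit C q).app U s = 0) : germ C U q hU s = 0 := by
  let adj := Scheme.Modules.pullbackPushforwardAdjunction (X.fromSpecStalk q)
  have h := (adj.homEquiv_unit (f := (adj.homEquiv _ _).symm (toPushforwardSkyscraper C q))).symm
  rw [Equiv.apply_symm_apply] at h
  have h1 : (toPushforwardSkyscraper C q).app U s = 0 := by
    rw [← h]
    exact comp_app_eq_zero _ _ hs
  exact congr_fun (h1 : (_ : SkySections _ (Stalk C q) (X.fromSpecStalk q ⁻¹ᵁ U)) = _)
    ⟨show X.fromSpecStalk q (IsLocalRing.closedPoint (X.presheaf.stalk q)) ∈ U by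
      rwa [Scheme.fromSpecStalk_closedPoint]⟩

lemma mem_sectionSub_kernelAt {C : Subobject F} {q : X} {U : X.Opens} {s : Γ(F, U)} :
    s ∈ sectionSub (kernelAt C q) U ↔
      ∃ a, C.arrow.app U a = s ∧ (localizationUnit (C : X.Modules) q).app U a = 0 := by
  rw [kernelAt, kernelSubobject, Subobject.map_mk, mem_sectionSub_mk]
  constructor
  · rintro ⟨a, rfl⟩
    exact ⟨_, rfl, congr(($(kernel.condition (localizationUnit (C : X.Modules) q))).app U a)⟩
  · rintro ⟨a, rfl, ha⟩
    obtain ⟨b, rfl⟩ := exists_of_app_eq_zero (kernel.condition _)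
      (kernelIsKernel (localizationUnit (C : X.Modules) q)) a ha
    exact ⟨b, rfl⟩

/-! ### Quasi-coherence as localization of sections on affine opens. -/

/-- The condition that sections of `M` over `D(f)` are the localization at `f` of the sections
over `U`, for all `f ∈ Γ(X, U)`. -/
structure LocalizesOn (M : X.Modules) (U : X.Opens) : Prop where
  surj : ∀ (f : Γ(X, U)) (s : Γ(M, X.basicOpen f)), ∃ (n : ℕ) (t : Γ(M, U)),
    res M (X.basicOpen_le f) t = X.presheaf.map (homOfLE (X.basicOpen_le f)).op (f ^ n) • s
  inj : ∀ (f : Γ(X, U)) (t : Γ(M, U)), res M (X.basicOpen_le f) t = 0 → ∃ n : ℕ, f ^ n • t = 0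

lemma fromSpec_appIso_inv {U : X.Opens} (hU : IsAffineOpen U) (V : (Spec Γ(X, U)).Opens)
    (h : hU.fromSpec ''ᵁ V ≤ U) :
    (Scheme.ΓSpecIso Γ(X, U)).inv ≫ (Spec Γ(X, U)).presheaf.map V.leTop.op ≫
      (hU.fromSpec.appIso V).inv = X.presheaf.map (homOfLE h).op := by
  rw [← Category.assoc, Iso.comp_inv_eq, Scheme.Hom.appIso_hom', Scheme.Hom.map_appLE,
    Scheme.Hom.appLE, hU.fromSpec_app_self, Category.assoc, ← Functor.map_comp]
  rfl

lemma smul_restrict_fromSpec {U : X.Opens} (hU : IsAffineOpen U) (M : X.Modules)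
    (V : (Spec Γ(X, U)).Opens) (h : hU.fromSpec ''ᵁ V ≤ U) (r : Γ(X, U))
    (s : Γ(M, hU.fromSpec ''ᵁ V)) :
    (show Γ(M, hU.fromSpec ''ᵁ V) from r • (show Γ(M.restrict hU.fromSpec, V) from s)) =
      X.presheaf.map (homOfLE h).op r • s := by
  rw [← fromSpec_appIso_inv hU V h]
  rfl

/-- Invertibility of f on D(f) is automatic, which leaves surjectivity and injectivity up to powers
of f. The opens V and W are variables because the images under `fromSpec` equal U and D(f) only
propositionally. -/
lemma isLocalizedModule_restrict_fromSpec_iff {U : X.Opens} (hU : IsAffineOpen U) (M : X.Modules)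
    (f : Γ(X, U)) {V W : X.Opens} (hV : hU.fromSpec ''ᵁ ⊤ = V)
    (hW : hU.fromSpec ''ᵁ (PrimeSpectrum.basicOpen f) = W) (hWV : W ≤ V) (hVU : V ≤ U) :
    IsLocalizedModule (.powers f) ((modulesSpecToSheaf.obj (M.restrict hU.fromSpec)).obj.map
      (PrimeSpectrum.basicOpen f).leTop.op).hom ↔
    (∀ s : Γ(M, W), ∃ (n : ℕ) (t : Γ(M, V)),
      res M hWV t = X.presheaf.map (homOfLE (hWV.trans hVU)).op (f ^ n) • s) ∧
    ∀ t : Γ(M, V), res M hWV t = 0 →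
      ∃ n : ℕ, X.presheaf.map (homOfLE hVU).op (f ^ n) • t = 0 := by
  subst hV hW
  let φ := ((modulesSpecToSheaf.obj (M.restrict hU.fromSpec)).obj.map
      (PrimeSpectrum.basicOpen f).leTop.op).hom
  constructor
  · intro h
    refine ⟨fun s ↦ ?_, fun t ht ↦ ?_⟩
    · obtain ⟨⟨t, ⟨_, n, rfl⟩⟩, ht⟩ := IsLocalizedModule.surj (.powers f) φ s
      exact ⟨n, t, ht.symm.trans (smul_restrict_fromSpec hU M _ _ _ _)⟩
    · obtain ⟨⟨_, n, rfl⟩, hn⟩ := (IsLocalizedModule.eq_zero_iff (.powers f) φ).mp ht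
      exact ⟨n, (smul_restrict_fromSpec hU M _ _ _ _).symm.trans hn⟩
  · rintro ⟨h1, h2⟩
    refine IsLocalizedModule.Away.mk_of_addCommGroup ?_ ?_ ?_
    · exact Scheme.Modules.isUnit_algebraMap_end_of_le_basicOpen f le_rfl
    · intro s
      obtain ⟨n, t, ht⟩ := h1 s
      exact ⟨n, t, (ht.trans (smul_restrict_fromSpec hU M _ _ _ _).symm).symm⟩
    · intro t ht
      obtain ⟨n, hn⟩ := h2 t ht
      exact ⟨n, (smul_restrict_fromSpec hU M _ _ _ _).trans hn⟩

lemma localizesOn_iff {U : X.Opens} (hU : IsAffineOpen U) (M : X.Modules) :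
    LocalizesOn M U ↔ (M.restrict hU.fromSpec).IsQuasicoherent := by
  have h1 : hU.fromSpec ''ᵁ ⊤ = U := by simp [hU.opensRange_fromSpec]
  have key (f : Γ(X, U)) := isLocalizedModule_restrict_fromSpec_iff hU M f h1
    (hU.fromSpec_image_basicOpen f) (X.basicOpen_le f) le_rfl
  have hid : X.presheaf.map (homOfLE (le_refl U)).op = 𝟙 _ := X.presheaf.map_id _
  simp only [hid] at key
  rw [isQuasicoherent_iff_isIso_fromTildeΓ, isIso_fromTildeΓ_iff_isLocalizing]
  exact ⟨fun h f ↦ (key f).mpr ⟨h.surj f, h.inj f⟩,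
    fun h ↦ ⟨fun f ↦ ((key f).mp (h f)).1, fun f ↦ ((key f).mp (h f)).2⟩⟩

lemma localizesOn_of_isQuasicoherent (M : X.Modules) (hM : M.IsQuasicoherent) {U : X.Opens}
    (hU : IsAffineOpen U) : LocalizesOn M U := by
  rw [localizesOn_iff hU]
  exact Scheme.Modules.isQuasicoherent_restrictFunctor _ _

/-- A presentation of the restriction of `M` to an open subscheme gives a presentation of
`M.over U`. -/
def presentationOver (M : X.Modules) (U : X.Opens) (P : (M.restrict U.ι).Presentation) :
    (SheafOfModules.over M U).Presentation :=
  letI e := Scheme.Modules.overEquiv U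
  letI F : SheafOfModules.{u} (U : Scheme.{u}).ringCatSheaf ⥤
      SheafOfModules.{u} (X.ringCatSheaf.over U) := e.inverse
  haveI : PreservesColimitsOfSize.{u, u} F := e.symm.toAdjunction.leftAdjoint_preservesColimits
  letI iso : F.obj (M.restrict U.ι) ≅ SheafOfModules.over M U :=
    e.inverse.mapIso ((Scheme.Modules.overFunctorEquiv U).app M).symm ≪≫
      (e.unitIso.app (SheafOfModules.over M U)).symm
  SheafOfModules.Presentation.ofIsIso.{u, u, u} iso.hom
    (P.map F (U.sheafOfModulesEquivOverInverseUnit X.ringCatSheaf).symm)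

/-- Transport a presentation along an isomorphism of `𝒪_X`-modules. -/
def presentationOfIso {M N : X.Modules} (e : M ≅ N) (P : SheafOfModules.Presentation M) :
    SheafOfModules.Presentation N :=
  letI f : (show SheafOfModules X.ringCatSheaf from M) ⟶ N := e.hom
  haveI : IsIso f := ⟨e.inv, e.hom_inv_id, e.inv_hom_id⟩
  SheafOfModules.Presentation.ofIsIso.{u, u, u} f P

lemma isQuasicoherent_of_localizesOn (M : X.Modules)
    (h : ∀ U : X.Opens, IsAffineOpen U → LocalizesOn M U) : M.IsQuasicoherent := by
  have h' (U : X.affineOpens) : (M.restrict (U : X.Opens).ι).Presentation := by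
    have hU : IsAffineOpen (U : X.Opens) := U.2
    have : (M.restrict hU.fromSpec).IsQuasicoherent := (localizesOn_iff hU M).mp (h U hU)
    have : IsIso (M.restrict hU.fromSpec).fromTildeΓ :=
      Scheme.Modules.isIso_fromTildeΓ_of_isQuasicoherent _
    -- The tilde module is presented with all sections as generators and all relations among them.
    let P := presentationOfIso (asIso (M.restrict hU.fromSpec).fromTildeΓ)
      (presentationTilde.{u} _ .univ (by simp) _ (Submodule.span_eq _))
    let e := (Scheme.Modules.restrictFunctorComp hU.isoSpec.hom hU.fromSpec).symm ≪≫
      Scheme.Modules.restrictFunctorCongr (show _ = (U : X.Opens).ι by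
        rw [IsAffineOpen.fromSpec, Iso.hom_inv_id_assoc])
    exact presentationOfIso (e.app M)
      (Scheme.Modules.presentationRestrict hU.isoSpec.hom P)
  let D : SheafOfModules.QuasicoherentData (R := X.ringCatSheaf) M :=
    { I := X.affineOpens
      X := fun U ↦ U.1
      coversTop := by
        rw [Opens.coversTop_iff, TopologicalSpace.IsOpenCover]
        exact iSup_affineOpens_eq_top X
      presentation := fun U ↦ presentationOver M U.1 (h' U) }
  exact D.isQuasicoherent

/-! ### Clearing denominators between stalks and sections over an affine open. -/

lemma isUnit_germ_iff {U : X.Opens} {x : X} (hx : x ∈ U) (f : Γ(X, U)) :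
    IsUnit (X.presheaf.germ U x hx f) ↔ x ∈ X.basicOpen f :=
  (X.mem_basicOpen f x hx).symm

lemma exists_smul_eq_zero {M : X.Modules} {U : X.Opens} (hU : IsAffineOpen U)
    (hM : LocalizesOn M U) {x : X} (hx : x ∈ U) (s : Γ(M, U)) (hs : germ M U x hx s = 0) :
    ∃ v : Γ(X, U), IsUnit (X.presheaf.germ U x hx v) ∧ v • s = 0 := by
  obtain ⟨V, hV, hVU, h⟩ := exists_res_eq_zero M hx s hs
  obtain ⟨f, hfV, hf⟩ := hU.exists_basicOpen_le ⟨x, hV⟩ hx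
  have h0 : res M (X.basicOpen_le f) s = 0 := by
    rw [← res_res M hfV hVU, h, map_zero]
  obtain ⟨n, hn⟩ := hM.inj f s h0
  refine ⟨f ^ n, ?_, hn⟩
  rw [map_pow]
  exact ((isUnit_germ_iff hx f).mpr hf).pow n

lemma exists_germ_eq_smul {M : X.Modules} {U : X.Opens} (hU : IsAffineOpen U)
    (hM : LocalizesOn M U) {x : X} (hx : x ∈ U) (t : Stalk M x) :
    ∃ (v : Γ(X, U)) (s : Γ(M, U)), IsUnit (X.presheaf.germ U x hx v) ∧
      germ M U x hx s = X.presheaf.germ U x hx v • t := by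
  obtain ⟨V, hV, hVU, t, rfl⟩ := exists_germ_eq M t hx
  obtain ⟨f, hfV, hf⟩ := hU.exists_basicOpen_le ⟨x, hV⟩ hx
  obtain ⟨n, s, hs⟩ := hM.surj f (res M hfV t)
  refine ⟨f ^ n, s, ?_, ?_⟩
  · rw [map_pow]
    exact ((isUnit_germ_iff hx f).mpr hf).pow n
  · rw [← germ_res M (X.basicOpen_le f) x hf, hs, germ_smul, germ_res,
      TopCat.Presheaf.germ_res_apply]

lemma exists_germ_eq_mul {U : X.Opens} (hU : IsAffineOpen U) {x : X} (hx : x ∈ U)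
    (r : X.presheaf.stalk x) : ∃ v a : Γ(X, U), IsUnit (X.presheaf.germ U x hx v) ∧
      X.presheaf.germ U x hx v * r = X.presheaf.germ U x hx a := by
  have := hU.isLocalization_stalk ⟨x, hx⟩
  let := X.presheaf.algebra_section_stalk ⟨x, hx⟩
  obtain ⟨⟨a, v⟩, h⟩ := IsLocalization.surj (hU.primeIdealOf ⟨x, hx⟩).asIdeal.primeCompl r
  exact ⟨v, a, IsLocalization.map_units _ v, (mul_comm _ _).trans h⟩

lemma exists_mem_sectionSub_germ_eq_smul {U : X.Opens} (hU : IsAffineOpen U) (A : Subobject F)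
    (hA : LocalizesOn (A : X.Modules) U) {x : X} (hx : x ∈ U) {t : Stalk F x}
    (ht : t ∈ stalkSub A x) :
    ∃ v : Γ(X, U), ∃ s ∈ sectionSub A U, IsUnit (X.presheaf.germ U x hx v) ∧
      germ F U x hx s = X.presheaf.germ U x hx v • t := by
  obtain ⟨t, rfl⟩ := ht
  obtain ⟨v, s, hv, hs⟩ := exists_germ_eq_smul hU hA hx t
  refine ⟨v, _, ⟨s, rfl⟩, hv, ?_⟩
  rw [← stalkMap_germ, hs, map_smul]

lemma exists_smul_mem_sectionSub {U : X.Opens} (hU : IsAffineOpen U) (A : Subobject F)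
    (hF : LocalizesOn F U) (hA : LocalizesOn (A : X.Modules) U) {x : X} (hx : x ∈ U) {s : Γ(F, U)}
    (hs : germ F U x hx s ∈ stalkSub A x) :
    ∃ v : Γ(X, U), IsUnit (X.presheaf.germ U x hx v) ∧ v • s ∈ sectionSub A U := by
  obtain ⟨v, a, ha, hv, h⟩ := exists_mem_sectionSub_germ_eq_smul hU A hA hx hs
  obtain ⟨w, hw, h'⟩ := exists_smul_eq_zero hU hF hx (v • s - a) (by
    rw [map_sub, germ_smul, h, sub_self])
  refine ⟨w * v, ?_, ?_⟩
  · rw [map_mul]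
    exact hw.mul hv
  · rw [smul_sub, sub_eq_zero, ← mul_smul] at h'
    rw [h']
    exact (sectionSub A U).smul_mem w ha

/-- Over an affine open, a subsheaf of a sheaf of modules whose sections localize has the same
property if and only if membership can be tested after multiplication by powers. -/
lemma localizesOn_subobject_iff {U : X.Opens} (hF : LocalizesOn F U) (A : Subobject F) :
    LocalizesOn (A : X.Modules) U ↔ ∀ (f : Γ(X, U)) (s : Γ(F, U)),
      res F (X.basicOpen_le f) s ∈ sectionSub A (X.basicOpen f) →
        ∃ n : ℕ, f ^ n • s ∈ sectionSub A U := by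
  constructor
  · rintro hA f s ⟨a, ha⟩
    obtain ⟨n, b, hb⟩ := hA.surj f a
    obtain ⟨m, hm⟩ := hF.inj f (f ^ n • s - A.arrow.app U b) (by
      rw [map_sub, res_smul, ← ha, ← app_res, hb, Scheme.Modules.Hom.app_smul, sub_self])
    refine ⟨m + n, f ^ m • b, ?_⟩
    rw [smul_sub, sub_eq_zero] at hm
    rw [pow_add, mul_smul, hm, Scheme.Modules.Hom.app_smul]
  · intro h
    refine ⟨fun f a ↦ ?_, fun f a ha ↦ ?_⟩
    · obtain ⟨n, t, ht⟩ := hF.surj f (A.arrow.app _ a)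
      obtain ⟨m, b, hb⟩ := h f t ⟨_, by rw [ht, ← Scheme.Modules.Hom.app_smul]⟩
      refine ⟨m + n, b, app_injective A.arrow _ ?_⟩
      rw [app_res, hb, res_smul, ht, Scheme.Modules.Hom.app_smul, pow_add, map_mul, mul_smul]
    · obtain ⟨n, hn⟩ := hF.inj f (A.arrow.app U a) (by rw [← app_res, ha, map_zero])
      refine ⟨n, app_injective A.arrow _ ?_⟩
      rw [Scheme.Modules.Hom.app_smul, hn, map_zero]

lemma fromSpec_mem {U : X.Opens} (hU : IsAffineOpen U)
    (P : PrimeSpectrum Γ(X, U)) : hU.fromSpec P ∈ U := by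
  have := Set.mem_range_self (f := hU.fromSpec) P
  rwa [hU.range_fromSpec] at this

lemma isUnit_germ_fromSpec {U : X.Opens} (hU : IsAffineOpen U)
    (P : PrimeSpectrum Γ(X, U)) (f : Γ(X, U)) :
    IsUnit (X.presheaf.germ U _ (fromSpec_mem hU P) f) ↔ f ∉ P.asIdeal := by
  rw [isUnit_germ_iff, ← PrimeSpectrum.mem_basicOpen, ← hU.fromSpec_preimage_basicOpen]
  rfl

lemma isUnit_germ_iff_notMem_primeIdealOf {U : X.Opens} (hU : IsAffineOpen U)
    {x : X} (hx : x ∈ U) (f : Γ(X, U)) :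
    IsUnit (X.presheaf.germ U x hx f) ↔ f ∉ (hU.primeIdealOf ⟨x, hx⟩).asIdeal := by
  rw [← isUnit_germ_fromSpec hU, isUnit_germ_iff, isUnit_germ_iff, hU.fromSpec_primeIdealOf]

lemma fromSpec_specializes {U : X.Opens} (hU : IsAffineOpen U)
    {x : X} (hx : x ∈ U) (P : PrimeSpectrum Γ(X, U))
    (h : P.asIdeal ≤ (hU.primeIdealOf ⟨x, hx⟩).asIdeal) : hU.fromSpec P ⤳ x := by
  have h1 : P ⤳ hU.primeIdealOf ⟨x, hx⟩ := (PrimeSpectrum.le_iff_specializes _ _).mp h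
  have h2 := h1.map hU.fromSpec.continuous
  rwa [hU.fromSpec_primeIdealOf] at h2

/-- If no power of f works, the annihilator of t avoids the monoid generated by f and the complement
of the prime of q. A prime P containing the annihilator and avoiding this monoid is a generization
of q in D(f), where t vanishes; so something outside P kills t, a contradiction. -/
lemma exists_germ_pow_smul_eq_zero {M : X.Modules} {U : X.Opens} (hU : IsAffineOpen U)
    (hM : LocalizesOn M U) {q : X} (hq : q ∈ U) (f : Γ(X, U)) (t : Γ(M, U))
    (h : ∀ (x : X) (hx : x ∈ U), x ⤳ q → x ∈ X.basicOpen f → germ M U x hx t = 0) :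
    ∃ n : ℕ, germ M U q hq (f ^ n • t) = 0 := by
  by_contra! hne
  let p := (hU.primeIdealOf ⟨q, hq⟩).asIdeal
  have hdisj : Disjoint (Ideal.torsionOf Γ(X, U) Γ(M, U) t : Set Γ(X, U))
      (p.primeCompl ⊔ Submonoid.powers f : Submonoid Γ(X, U)) := by
    rw [Set.disjoint_left]
    rintro a ha ha'
    obtain ⟨v, hv, _, ⟨n, rfl⟩, rfl⟩ := Submonoid.mem_sup.mp ha'
    have hv' : IsUnit (X.presheaf.germ U q hq v) :=
      (isUnit_germ_iff_notMem_primeIdealOf hU hq v).mpr hv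
    refine hne n ?_
    have h0 : v • f ^ n • t = 0 := by rw [← mul_smul]; exact ha
    rw [← hv'.smul_eq_zero, ← germ_smul, h0, map_zero]
  obtain ⟨P, hP, hle, hd⟩ := Ideal.exists_le_prime_disjoint _ _ hdisj
  rw [Set.disjoint_left] at hd
  have hPp : P ≤ p := fun a ha ↦ by
    by_contra hap
    exact hd ha (Submonoid.mem_sup_left hap)
  have hf : f ∉ P := fun hfP ↦ hd hfP (Submonoid.mem_sup_right (Submonoid.mem_powers f))
  have hx := h _ (fromSpec_mem hU ⟨P, hP⟩) (fromSpec_specializes hU hq ⟨P, hP⟩ hPp)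
    ((isUnit_germ_iff (fromSpec_mem hU ⟨P, hP⟩) f).mp ((isUnit_germ_fromSpec hU ⟨P, hP⟩ f).mpr hf))
  obtain ⟨v, hv, hvt⟩ := exists_smul_eq_zero hU hM _ t hx
  exact (isUnit_germ_fromSpec hU ⟨P, hP⟩ v).mp hv (hle hvt)

/-! ### Associated primes and vanishing of stalks. -/

/-- The annihilator of the class of s in M/A lies in p, and a minimal prime over it inside p is
associated to the cyclic module generated by that class. -/
lemma exists_prime_of_smul_notMem {R M : Type*} [CommRing R] [IsNoetherianRing R] [AddCommGroup M]
    [Module R M] (A : Submodule R M) (p : Ideal R) [p.IsPrime] (s : M)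
    (hs : ∀ a ∉ p, a • s ∉ A) : ∃ (P : Ideal R) (_ : P.IsPrime) (r : R), P ≤ p ∧
      ∀ a, a • r • s ∈ A ↔ a ∈ P := by
  let N := Submodule.span R {A.mkQ s}
  have hN : Module.annihilator R N ≤ p := fun a ha ↦ by
    by_contra hap
    have h := (Submodule.mem_annihilator.mp ha) _ (Submodule.mem_span_singleton_self (A.mkQ s))
    rw [← map_smul, Submodule.mkQ_apply, Submodule.Quotient.mk_eq_zero] at h
    exact hs a hap h
  obtain ⟨P, hP, hPp⟩ := Ideal.exists_minimalPrimes_le hN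
  have hPa : IsAssociatedPrime P N :=
    Module.associatedPrimes.minimalPrimes_annihilator_subset_associatedPrimes R N hP
  obtain ⟨hP', ⟨n, hn⟩, hPn⟩ := isAssociatedPrime_iff.mp hPa
  obtain ⟨r, rfl⟩ := Submodule.mem_span_singleton.mp hn
  refine ⟨P, hP', r, hPp, fun a ↦ ?_⟩
  rw [hPn, Submodule.mem_colon_singleton, Submodule.mem_bot, ← Submodule.coe_eq_zero]
  change _ ↔ a • r • A.mkQ s = 0
  rw [← map_smul, ← map_smul, Submodule.mkQ_apply, Submodule.Quotient.mk_eq_zero]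

lemma exists_isAffineOpen_mem (x : X) : ∃ U : X.Opens, IsAffineOpen U ∧ x ∈ U := by
  obtain ⟨_, ⟨U, hU, rfl⟩, hx, -⟩ := X.isBasis_affineOpens.exists_subset_of_mem_open
    (Set.mem_univ x) isOpen_univ
  exact ⟨U, hU, hx⟩

/-- A germ in B_q outside A_q yields, after clearing denominators on an affine open, an associated
prime of B/A inside the prime of q, hence an associated point generizing q. -/
lemma stalkSub_le_of_forall_not_specializes [IsLocallyNoetherian X]
    (hF : ∀ U : X.Opens, IsAffineOpen U → LocalizesOn F U) {A B : Subobject F}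
    (hA : ∀ U : X.Opens, IsAffineOpen U → LocalizesOn (A : X.Modules) U)
    (hB : ∀ U : X.Opens, IsAffineOpen U → LocalizesOn (B : X.Modules) U) (hAB : A ≤ B) (q : X)
    (h : ∀ x ∈ assPoints (subquotient A B hAB), ¬ x ⤳ q) : stalkSub B q ≤ stalkSub A q := by
  intro t ht
  obtain ⟨U, hU, hq⟩ := exists_isAffineOpen_mem q
  have := IsLocallyNoetherian.component_noetherian (X := X) ⟨U, hU⟩
  obtain ⟨v, s, hs, hv, hvt⟩ := exists_mem_sectionSub_germ_eq_smul hU B (hB U hU) hq ht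
  rw [← Submodule.smul_mem_iff_of_isUnit _ hv, ← hvt]
  by_contra hsA
  have hs' : ∀ a ∉ (hU.primeIdealOf ⟨q, hq⟩).asIdeal, a • s ∉ sectionSub A U := by
    intro a ha ha'
    rw [← isUnit_germ_iff_notMem_primeIdealOf] at ha
    have := germ_mem_stalkSub A ha' q hq
    rw [germ_smul, Submodule.smul_mem_iff_of_isUnit _ ha] at this
    exact hsA this
  obtain ⟨P, hP, r, hPq, hr⟩ := exists_prime_of_smul_notMem _ _ s hs'
  have hx := fromSpec_mem hU ⟨P, hP⟩
  refine h (hU.fromSpec ⟨P, hP⟩) ?_ (fromSpec_specializes hU hq ⟨P, hP⟩ hPq)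
  rw [mem_assPoints_subquotient]
  -- The germ of r • s is the witness; each ρ in the local ring is replaced by a section a, up to a
  -- unit w.
  refine ⟨_, germ_mem_stalkSub B ((sectionSub B U).smul_mem r hs) _ hx, fun ρ ↦ ?_⟩
  obtain ⟨w, a, hw, hwa⟩ := exists_germ_eq_mul hU hx ρ
  rw [← Submodule.smul_mem_iff_of_isUnit _ hw, ← mul_smul, hwa, ← germ_smul,
    IsLocalRing.mem_maximalIdeal, mem_nonunits_iff, ← hw.mul_left_iff, hwa,
    isUnit_germ_fromSpec hU ⟨P, hP⟩ a, not_not]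
  constructor
  · intro h1
    obtain ⟨b, hb, hb'⟩ := exists_smul_mem_sectionSub hU A (hF U hU) (hA U hU) hx h1
    rw [← mul_smul, hr] at hb'
    exact (hP.mem_or_mem hb').resolve_left ((isUnit_germ_fromSpec hU ⟨P, hP⟩ b).mp hb)
  · intro h1
    exact germ_mem_stalkSub A ((hr a).mpr h1) _ hx

lemma IsCoherent.localizesOn {M : X.Modules} (hM : IsCoherent M) (U : X.Opens)
    (hU : IsAffineOpen U) : LocalizesOn M U :=
  localizesOn_of_isQuasicoherent M hM.quasicoherent hU

/-! ### The kernel subsheaf when C vanishes at the proper generizations of q. -/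

/-- If `C` vanishes at the proper generizations of `q`, then the sections of the kernel of the
localization of `C` at `q` are those sections of `C` whose germ at `q` vanishes. -/
lemma mem_sectionSub_kernelAt_iff {C : Subobject F} {q : X}
    (h0 : ∀ x, x ⤳ q → x ≠ q → stalkSub C x = ⊥) {U : X.Opens} {s : Γ(F, U)} :
    s ∈ sectionSub (kernelAt C q) U ↔
      s ∈ sectionSub C U ∧ ∀ hq : q ∈ U, germ F U q hq s = 0 := by
  rw [mem_sectionSub_kernelAt]
  constructor
  · rintro ⟨a, rfl, ha⟩
    refine ⟨⟨a, rfl⟩, fun hq ↦ ?_⟩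
    rw [← stalkMap_germ, germ_eq_zero_of_localizationUnit _ q hq a ha, map_zero]
  · rintro ⟨⟨a, rfl⟩, h⟩
    refine ⟨a, rfl, localizationUnit_app_eq_zero _ _ _ fun x hx hxq ↦
      stalkMap_injective C.arrow x ?_⟩
    rw [map_zero]
    by_cases hxq' : x = q
    · subst hxq'
      rw [stalkMap_germ]
      exact h hx
    · have := LinearMap.mem_range_self (stalkMap C.arrow x) (germ _ U x hx a)
      change _ ∈ stalkSub C x at this
      rwa [h0 x hxq hxq', Submodule.mem_bot] at this

lemma germ_eq_of_specializes (M : X.Modules) {x y : X} (h : x ⤳ y) {U V : X.Opens} (hU : y ∈ U)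
    (hV : y ∈ V) {s : Γ(M, U)} {t : Γ(M, V)} (hst : germ M U y hU s = germ M V y hV t) :
    germ M U x (h.mem_open U.2 hU) s = germ M V x (h.mem_open V.2 hV) t := by
  have e := congrArg (M.presheaf.stalkSpecializes h) hst
  exact (congr($(M.presheaf.germ_stalkSpecializes hU h) s)).symm.trans
    (e.trans (congr($(M.presheaf.germ_stalkSpecializes hV h) t)))

lemma stalkSub_kernelAt_self {C : Subobject F} {q : X}
    (h0 : ∀ x, x ⤳ q → x ≠ q → stalkSub C x = ⊥) : stalkSub (kernelAt C q) q = ⊥ := by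
  refine le_bot_iff.mp fun t ht ↦ ?_
  obtain ⟨U, hU, -, s, hs, rfl⟩ := exists_of_mem_stalkSub _ ht (V := ⊤) trivial
  exact ((mem_sectionSub_kernelAt_iff h0).mp hs).2 hU

lemma kernelAt_le (C : Subobject F) (q : X) : kernelAt C q ≤ C := by
  refine le_iff_stalkSub_le.mpr fun x t ht ↦ ?_
  obtain ⟨U, hU, -, s, hs, rfl⟩ := exists_of_mem_stalkSub _ ht (V := ⊤) trivial
  obtain ⟨a, rfl, -⟩ := mem_sectionSub_kernelAt.mp hs
  exact germ_mem_stalkSub C ⟨a, rfl⟩ x hU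

lemma le_kernelAt {A C : Subobject F} {q : X} (h0 : ∀ x, x ⤳ q → x ≠ q → stalkSub C x = ⊥)
    (hAC : A ≤ C) (hA : stalkSub A q = ⊥) : A ≤ kernelAt C q := by
  refine le_iff_stalkSub_le.mpr fun x t ht ↦ ?_
  obtain ⟨U, hU, -, s, hs, rfl⟩ := exists_of_mem_stalkSub _ ht (V := ⊤) trivial
  refine germ_mem_stalkSub _ ((mem_sectionSub_kernelAt_iff h0).mpr
    ⟨(mem_sectionSub_iff C s).mpr fun y hy ↦ ?_, fun hq ↦ ?_⟩) x hU
  · exact le_iff_stalkSub_le.mp hAC y (germ_mem_stalkSub A hs y hy)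
  · have := germ_mem_stalkSub A hs q hq
    rwa [hA] at this

/-- On the complement of the closure of q, the condition on the germ at q is vacuous. -/
lemma stalkSub_kernelAt_of_not_specializes {C : Subobject F} {q : X}
    (h0 : ∀ x, x ⤳ q → x ≠ q → stalkSub C x = ⊥) {x : X} (hx : ¬ q ⤳ x) :
    stalkSub (kernelAt C q) x = stalkSub C x := by
  refine le_antisymm (le_iff_stalkSub_le.mp (kernelAt_le C q) x) fun t ht ↦ ?_
  have hx' : x ∈ (⟨(closure {q})ᶜ, isClosed_closure.isOpen_compl⟩ : X.Opens) := fun h ↦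
    hx (specializes_iff_mem_closure.mpr h)
  obtain ⟨U, hU, hUV, s, hs, rfl⟩ := exists_of_mem_stalkSub _ ht hx'
  exact germ_mem_stalkSub _ ((mem_sectionSub_kernelAt_iff h0).mpr
    ⟨hs, fun hq ↦ (hUV hq (subset_closure rfl)).elim⟩) x hU

lemma isCoherent_kernelAt [IsLocallyNoetherian X] (hF : IsCoherent F) {C : Subobject F}
    (hC : IsCoherent (C : X.Modules)) {q : X} (h0 : ∀ x, x ⤳ q → x ≠ q → stalkSub C x = ⊥) :
    IsCoherent (kernelAt C q : X.Modules) := by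
  refine ⟨isQuasicoherent_of_localizesOn _ fun U hU ↦
    (localizesOn_subobject_iff (hF.localizesOn U hU) _).mpr fun f s hs ↦ ?_, fun U hU ↦ ?_⟩
  · rw [mem_sectionSub_kernelAt_iff h0] at hs
    obtain ⟨n, hn⟩ := (localizesOn_subobject_iff (hF.localizesOn U hU) C).mp
      (hC.localizesOn U hU) f s hs.1
    by_cases hq : q ∈ U
    -- Once f ^ n • s lies in C, its germs vanish at all generizations of q in D(f), so a further
    -- power of f kills the germ at q.
    · obtain ⟨m, hm⟩ := exists_germ_pow_smul_eq_zero hU (hF.localizesOn U hU) hq f (f ^ n • s)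
        fun x hx hxq hxf ↦ by
          by_cases hxq' : x = q
          · subst hxq'
            rw [germ_smul, ← germ_res F (X.basicOpen_le f) x hxf s, hs.2 hxf, smul_zero]
          · have := germ_mem_stalkSub C hn x hx
            rwa [h0 x hxq hxq'] at this
      refine ⟨m + n, (mem_sectionSub_kernelAt_iff h0).mpr ?_⟩
      rw [pow_add, mul_smul]
      exact ⟨Submodule.smul_mem _ _ hn, fun _ ↦ hm⟩
    · exact ⟨n, (mem_sectionSub_kernelAt_iff h0).mpr ⟨hn, fun h ↦ (hq h).elim⟩⟩
  · have := IsLocallyNoetherian.component_noetherian (X := X) ⟨U, hU⟩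
    have := hF.finite U hU
    let φ : Γ((kernelAt C q : X.Modules), U) →ₗ[Γ(X, U)] Γ(F, U) :=
      { toFun := (kernelAt C q).arrow.app U
        map_add' := map_add ((kernelAt C q).arrow.app U).hom
        map_smul' := fun r a ↦ (kernelAt C q).arrow.app_smul r a }
    exact Module.Finite.of_injective φ (app_injective (kernelAt C q).arrow U)

lemma assPoints_subquotient_kernelAt_subset {C : Subobject F} {q : X}
    (h0 : ∀ x, x ⤳ q → x ≠ q → stalkSub C x = ⊥) :
    assPoints (subquotient _ C (kernelAt_le C q)) ⊆ {q} := by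
  intro x hx
  obtain ⟨t, ht, h⟩ := (mem_assPoints_subquotient _ _).mp hx
  have htK : t ∉ stalkSub (kernelAt C q) x := fun htK ↦
    Ideal.one_notMem _ ((h 1).mp (by rwa [one_smul]))
  have hqx : q ⤳ x := by
    by_contra hqx
    exact htK (by rwa [stalkSub_kernelAt_of_not_specializes h0 hqx])
  by_contra hxq
  obtain ⟨V, hV, hxV⟩ := exists_isAffineOpen_mem x
  obtain ⟨U, hU, hUV, s, hs, rfl⟩ := exists_of_mem_stalkSub C ht hxV
  have hqV : q ∈ V := hqx.mem_open V.2 hxV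
  have hqU : q ∈ U := hqx.mem_open U.2 hU
  have hxq' : ¬ x ⤳ q := fun hxq' ↦ hxq (hxq'.antisymm hqx).eq
  have hq' : q ∈ V ⊓ (⟨(closure {x})ᶜ, isClosed_closure.isOpen_compl⟩ : X.Opens) :=
    ⟨hqV, fun h ↦ hxq' (specializes_iff_mem_closure.mpr h)⟩
  -- Here x is a proper specialization of q, so some f vanishes at x and is invertible at q. Then f
  -- • s lies in the kernel near x, so its germ at q is zero; hence so is that of s.
  obtain ⟨f, hf, hqf⟩ := hV.exists_basicOpen_le ⟨q, hq'⟩ hqV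
  have hxf : x ∉ X.basicOpen f := fun hxf ↦ (hf hxf).2 (subset_closure rfl)
  have hfm : X.presheaf.germ V x hxV f ∈ IsLocalRing.maximalIdeal _ := by
    rwa [IsLocalRing.mem_maximalIdeal, mem_nonunits_iff, isUnit_germ_iff]
  let g : Γ(X, U) := X.presheaf.map (homOfLE hUV).op f
  have hgx : X.presheaf.germ U x hU g = X.presheaf.germ V x hxV f :=
    TopCat.Presheaf.germ_res_apply _ _ _ _ _
  have hgq : X.presheaf.germ U q hqU g = X.presheaf.germ V q hqV f :=
    TopCat.Presheaf.germ_res_apply _ _ _ _ _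
  rw [← h, ← hgx, ← germ_smul] at hfm
  obtain ⟨W, hW, -, s', hs', e⟩ := exists_of_mem_stalkSub _ hfm hU
  have e' := germ_eq_of_specializes F hqx hW hU e
  rw [((mem_sectionSub_kernelAt_iff h0).mp hs').2, germ_smul, hgq, eq_comm,
    ((isUnit_germ_iff hqV f).mpr hqf).smul_eq_zero] at e'
  exact htK (germ_mem_stalkSub _ ((mem_sectionSub_kernelAt_iff h0).mpr ⟨hs, fun _ ↦ e'⟩) x hU)

/-! ### Associated points along a filtration. -/

lemma mem_assPoints_subquotient_of_notMem {A B : Subobject F} (h : A ≤ B) {x : X} {t : Stalk F x}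
    (ht : t ∈ stalkSub B x) (htA : t ∉ stalkSub A x)
    (hm : ∀ r ∈ IsLocalRing.maximalIdeal (X.presheaf.stalk x), r • t ∈ stalkSub A x) :
    x ∈ assPoints (subquotient A B h) := by
  refine (mem_assPoints_subquotient h x).mpr ⟨t, ht, fun r ↦ ⟨fun hr ↦ ?_, hm r⟩⟩
  rw [IsLocalRing.mem_maximalIdeal, mem_nonunits_iff]
  intro hu
  exact htA ((Submodule.smul_mem_iff_of_isUnit _ hu).mp hr)

lemma assPoints_subquotient_congr {A B A' B' : Subobject F} {h : A ≤ B} {h' : A' ≤ B'}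
    (hA : A = A') (hB : B = B') :
    assPoints (subquotient A B h) = assPoints (subquotient A' B' h') := by
  subst hA hB
  rfl

/-- A germ with annihilator the maximal ideal has a nonzero class in the graded piece at the first
step containing it, and that class is still killed by the maximal ideal. -/
lemma exists_mem_assPoints_gr {n : ℕ} (𝓕 : Fin (n + 1) →o Subobject F) (h0 : 𝓕 0 = ⊥)
    (h1 : 𝓕 (Fin.last n) = ⊤) {x : X} (hx : x ∈ assPoints F) :
    ∃ k, x ∈ assPoints (gr 𝓕 k) := by
  obtain ⟨t, ht⟩ := (mem_assPoints_iff F x).mp hx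
  have key (k : Fin (n + 1)) : t ∈ stalkSub (𝓕 k) x → ∃ k, x ∈ assPoints (gr 𝓕 k) := by
    induction k using Fin.induction with
    | zero =>
      intro h
      rw [h0, stalkSub_bot, Submodule.mem_bot] at h
      exact (Ideal.one_notMem _ ((ht 1).mp (by rw [h, smul_zero]))).elim
    | succ k ih =>
      intro h
      by_cases h' : t ∈ stalkSub (𝓕 k.castSucc) x
      · exact ih h'
      · refine ⟨k, mem_assPoints_subquotient_of_notMem _ h h' fun r hr ↦ ?_⟩
        rw [(ht r).mpr hr]
        exact Submodule.zero_mem _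
  exact key (Fin.last n) (by rw [h1, stalkSub_top]; trivial)

lemma stalkSub_eq_bot_of_forall_not_specializes [IsLocallyNoetherian X] (hF : IsCoherent F) {n : ℕ}
    (𝓕 : Fin (n + 1) →o Subobject F) (h0 : 𝓕 0 = ⊥)
    (h𝓕 : ∀ k, IsCoherent (𝓕 k : X.Modules)) (x : X) (k : Fin (n + 1))
    (h : ∀ l : Fin n, l.castSucc < k → ∀ y ∈ assPoints (gr 𝓕 l), ¬ y ⤳ x) :
    stalkSub (𝓕 k) x = ⊥ := by
  induction k using Fin.induction with
  | zero => rw [h0, stalkSub_bot]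
  | succ k ih =>
    refine le_bot_iff.mp ?_
    rw [← ih fun l hl ↦ h l (hl.trans Fin.castSucc_lt_succ)]
    exact stalkSub_le_of_forall_not_specializes hF.localizesOn (h𝓕 _).localizesOn
      (h𝓕 _).localizesOn _ x (h k Fin.castSucc_lt_succ)

lemma assPoints_subquotient_kernelAt_subset_of_subquotient {A B C : Subobject F} (hAB : A ≤ B)
    (hBC : B ≤ C) {q : X} (h0 : ∀ x, x ⤳ q → x ≠ q → stalkSub C x = ⊥)
    (hB : assPoints (subquotient A B hAB) ⊆ {q}) (hAK : A ≤ kernelAt C q) :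
    assPoints (subquotient A _ hAK) ⊆ assPoints (subquotient B C hBC) := by
  intro x hx
  obtain ⟨t, ht, h⟩ := (mem_assPoints_subquotient _ _).mp hx
  have htA : t ∉ stalkSub A x := fun htA ↦
    Ideal.one_notMem _ ((h 1).mp (by rwa [one_smul]))
  by_cases htB : t ∈ stalkSub B x
  · obtain rfl : x = q :=
      hB (mem_assPoints_subquotient_of_notMem hAB htB htA fun r hr ↦ (h r).mpr hr)
    rw [stalkSub_kernelAt_self h0, Submodule.mem_bot] at ht
    exact (htA (ht ▸ Submodule.zero_mem _)).elim
  · exact mem_assPoints_subquotient_of_notMem hBC (le_iff_stalkSub_le.mp (kernelAt_le C q) x ht) htB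
      fun r hr ↦ le_iff_stalkSub_le.mp hAB x ((h r).mpr hr)

lemma mem_assPoints_subquotient_kernelAt {A B C : Subobject F} (hAB : A ≤ B) (hBC : B ≤ C) {q : X}
    (h0 : ∀ x, x ⤳ q → x ≠ q → stalkSub C x = ⊥) (hA : stalkSub A q = ⊥)
    (hB : q ∈ assPoints (subquotient A B hAB)) :
    q ∈ assPoints (subquotient _ C (kernelAt_le C q)) := by
  rw [mem_assPoints_subquotient] at hB ⊢
  obtain ⟨t, ht, h⟩ := hB
  refine ⟨t, le_iff_stalkSub_le.mp hBC q ht, ?_⟩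
  rwa [stalkSub_kernelAt_self h0, ← hA]

/-! ### Exchanging two neighbours in the total order. -/

/-- An adjacent transposition reverses only the pair it exchanges. -/
lemma swap_lt_swap {n : ℕ} {i j : Fin n} (hji : (j : ℕ) + 1 = i) {k l : Fin n} (hkl : k < l)
    (h : ¬ (k = j ∧ l = i)) : Equiv.swap i j k < Equiv.swap i j l := by
  simp only [Equiv.swap_apply_def]
  split_ifs <;> simp only [Fin.lt_def, Fin.ext_iff, not_and] at * <;> omega

lemma isLinearExtension_of_equiv {F : X.Modules} {n : ℕ} (e : Fin n ≃ assPoints F)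
    (he : ∀ a b : assPoints F, closure {(a : X)} ⊂ closure {(b : X)} → e.symm a < e.symm b) :
    IsLinearExtension F fun a b ↦ e.symm b < e.symm a where
  strictTotal :=
    { trichotomous := fun _ _ h1 h2 ↦ e.symm.injective (le_antisymm (not_lt.mp h1) (not_lt.mp h2))
      irrefl := fun _ ↦ lt_irrefl _
      trans := fun _ _ _ h1 h2 ↦ h2.trans h1 }
  extends_closure := he

lemma IsLinearExtension.symm_lt_symm {F : X.Modules} {n : ℕ}
    {r : assPoints F → assPoints F → Prop} (hr : IsLinearExtension F r)
    {e : Fin n ≃ assPoints F} (he : ∀ i j, i < j → r (e j) (e i)) {a b : assPoints F}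
    (hab : closure {(a : X)} ⊂ closure {(b : X)}) : e.symm a < e.symm b := by
  have := hr.strictTotal
  rcases lt_trichotomy (e.symm a) (e.symm b) with h | h | h
  · exact h
  · rw [e.symm.injective h] at hab
    exact (ssubset_irrefl _ hab).elim
  · have h' := he _ _ h
    rw [Equiv.apply_symm_apply, Equiv.apply_symm_apply] at h'
    exact (asymm_of r h' (hr.extends_closure _ _ hab)).elim

lemma closure_singleton_ssubset_of_specializes {x y : X} (h : x ⤳ y) (hne : x ≠ y) :
    closure {y} ⊂ closure {x} :=
  ⟨h.closure_subset, fun h' ↦ hne (h.antisymm (specializes_iff_closure_subset.mpr h')).eq⟩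

end CoprimaryFiltration

end

theorem corollary4p2 {X : Scheme.{u}} [AlgebraicGeometry.IsNoetherian X] (F : X.Modules)
    (hF : CoprimaryFiltration.IsCoherent F) (hF0 : ¬ IsZero F)
    {n : ℕ} (𝓕 : Fin (n + 1) →o Subobject F)
    (h𝓕 : CoprimaryFiltration.IsCoprimaryFiltration 𝓕)
    (i j : Fin n) (hji : (j : ℕ) + 1 = (i : ℕ)) (p q : X)
    (hp : CoprimaryFiltration.assPoints (CoprimaryFiltration.gr 𝓕 i) = {p})
    (hq : CoprimaryFiltration.assPoints (CoprimaryFiltration.gr 𝓕 j) = {q})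
    (hpq : ¬ closure {q} ⊆ closure {p}) :
    ∃ 𝓖 : Fin (n + 1) →o Subobject F,
      (∀ k, k ≠ i.castSucc → 𝓖 k = 𝓕 k) ∧
      𝓖 i.castSucc = CoprimaryFiltration.kernelAt (𝓕 i.succ) q ∧
      CoprimaryFiltration.IsCoprimaryFiltration 𝓖 ∧
      CoprimaryFiltration.assPoints (CoprimaryFiltration.gr 𝓖 i) = {q} ∧
      CoprimaryFiltration.assPoints (CoprimaryFiltration.gr 𝓖 j) = {p} := by
  open CoprimaryFiltration in
  obtain ⟨r, hr, e, he, hgr⟩ := h𝓕.exists_order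
  have hei : (e i : X) = p := Set.singleton_injective ((hgr i).symm.trans hp)
  have hej : (e j : X) = q := Set.singleton_injective ((hgr j).symm.trans hq)
  have hpq' : p ≠ q := by
    rintro rfl
    exact hpq subset_rfl
  have hij : i ≠ j := by
    rintro rfl
    omega
  -- Graded pieces are indexed from 0: the term to be replaced is the top of piece j and the bottom
  -- of piece i.
  have hsucc : i.castSucc = j.succ := Fin.ext hji.symm
  have hAB : 𝓕 j.castSucc ≤ 𝓕 j.succ := 𝓕.monotone (Fin.castSucc_le_succ j)
  have hBC : 𝓕 j.succ ≤ 𝓕 i.succ := hsucc ▸ 𝓕.monotone (Fin.castSucc_le_succ i)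
  have hAB' : assPoints (subquotient _ _ hAB) = {q} := hq
  have hBC' : assPoints (subquotient _ _ hBC) = {p} :=
    (assPoints_subquotient_congr (congrArg 𝓕 hsucc.symm) rfl).trans hp
  have hA (x : X) (hx : x ⤳ q) : stalkSub (𝓕 j.castSucc) x = ⊥ := by
    refine stalkSub_eq_bot_of_forall_not_specializes hF 𝓕 h𝓕.eq_bot h𝓕.coherent x _
      fun l hl y hy hyx ↦ ?_
    rw [hgr l, Set.mem_singleton_iff] at hy
    have hlj : l < j := hl
    -- A point listed before q and generizing q would have strictly larger closure, so the order
    -- would place it after q.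
    have hne : (e l : X) ≠ e j := fun h ↦ hlj.ne (e.injective (Subtype.ext h))
    have hs : (e l : X) ⤳ e j := by
      rw [hej, ← hy]
      exact hyx.trans hx
    have := hr.symm_lt_symm he (closure_singleton_ssubset_of_specializes hs hne)
    rw [Equiv.symm_apply_apply, Equiv.symm_apply_apply] at this
    exact lt_asymm hlj this
  have h0 (x : X) (hx : x ⤳ q) (hxq : x ≠ q) : stalkSub (𝓕 i.succ) x = ⊥ := by
    refine le_bot_iff.mp ((stalkSub_le_of_forall_not_specializes hF.localizesOn
      (h𝓕.coherent _).localizesOn (h𝓕.coherent _).localizesOn hBC x ?_).trans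
      ((stalkSub_le_of_forall_not_specializes hF.localizesOn
      (h𝓕.coherent _).localizesOn (h𝓕.coherent _).localizesOn hAB x ?_).trans (hA x hx).le))
    · rw [hBC']
      rintro _ rfl hpx
      exact hpq (hpx.trans hx).closure_subset
    · rw [hAB']
      rintro _ rfl hqx
      exact hxq (hx.antisymm hqx).eq
  have hAK := le_kernelAt h0 (hAB.trans hBC) (hA q specializes_rfl)
  have hne0 : (0 : Fin (n + 1)) ≠ i.castSucc := hsucc ▸ (Fin.succ_ne_zero j).symm
  have hnel : Fin.last n ≠ i.castSucc := (Fin.castSucc_lt_last i).ne'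
  let g := Function.update 𝓕 i.castSucc (kernelAt (𝓕 i.succ) q)
  have hgne (k) (hk : k ≠ i.castSucc) : g k = 𝓕 k := Function.update_of_ne hk _ _
  have hgi : g i.castSucc = kernelAt (𝓕 i.succ) q := Function.update_self _ _ _
  have hgis : g i.succ = 𝓕 i.succ := hgne _ Fin.castSucc_lt_succ.ne'
  have hgj : g j.castSucc = 𝓕 j.castSucc :=
    hgne _ fun h ↦ hij (Fin.castSucc_injective _ h).symm
  have hgk (k) (hki : k ≠ i) : g k.castSucc = 𝓕 k.castSucc :=
    hgne _ fun h ↦ hki (Fin.castSucc_injective _ h)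
  have hgk' (k) (hkj : k ≠ j) : g k.succ = 𝓕 k.succ :=
    hgne _ fun h ↦ hkj (Fin.succ_injective _ (h.trans hsucc))
  have hmono : Monotone g := by
    refine Fin.monotone_iff_le_succ.mpr fun k ↦ ?_
    by_cases hki : k = i
    · subst hki
      rw [hgi, hgis]
      exact kernelAt_le _ _
    · rw [hgk k hki]
      by_cases hkj : k = j
      · subst hkj
        rwa [← hsucc, hgi]
      · rw [hgk' k hkj]
        exact 𝓕.monotone (Fin.castSucc_le_succ k)
  let 𝓖 : Fin (n + 1) →o Subobject F := ⟨g, hmono⟩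
  have hi : assPoints (gr 𝓖 i) = {q} := by
    refine (assPoints_subquotient_congr (h' := kernelAt_le _ _) hgi hgis).trans
      ((assPoints_subquotient_kernelAt_subset h0).antisymm (Set.singleton_subset_iff.mpr ?_))
    exact mem_assPoints_subquotient_kernelAt hAB hBC h0 (hA q specializes_rfl) (hAB' ▸ rfl)
  have hk (k) (hki : k ≠ i) (hkj : k ≠ j) : assPoints (gr 𝓖 k) = {(e k : X)} :=
    (assPoints_subquotient_congr (h' := 𝓕.monotone (Fin.castSucc_le_succ k))
      (hgk k hki) (hgk' k hkj)).trans (hgr k)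
  have hj_subset : assPoints (gr 𝓖 j) ⊆ {p} := by
    rw [← hBC']
    refine (assPoints_subquotient_congr (h' := hAK) hgj
      ((congrArg g hsucc.symm).trans hgi)).trans_subset ?_
    exact assPoints_subquotient_kernelAt_subset_of_subquotient hAB hBC h0 hAB'.le hAK
  have hj : assPoints (gr 𝓖 j) = {p} := by
    refine hj_subset.antisymm (Set.singleton_subset_iff.mpr ?_)
    -- The point p is associated to F, so it occurs in some graded piece of the new chain; every
    -- piece other than j has a different associated point.
    obtain ⟨k, hpk⟩ := exists_mem_assPoints_gr 𝓖 ((hgne 0 hne0).trans h𝓕.eq_bot)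
      ((hgne _ hnel).trans h𝓕.eq_top) (hei ▸ (e i).2)
    by_cases hki : k = i
    · rw [hki, hi] at hpk
      exact (hpq' hpk).elim
    · by_cases hkj : k = j
      · rwa [hkj] at hpk
      · rw [hk k hki hkj, ← hei] at hpk
        exact (hki (e.injective (Subtype.ext hpk)).symm).elim
  refine ⟨𝓖, hgne, hgi, ⟨(hgne 0 hne0).trans h𝓕.eq_bot, (hgne _ hnel).trans h𝓕.eq_top,
    fun k ↦ ?_, _, isLinearExtension_of_equiv ((Equiv.swap i j).trans e) fun a b hab ↦ ?_,
    (Equiv.swap i j).trans e, fun k l hkl ↦ ?_, fun k ↦ ?_⟩, hi, hj⟩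
  · by_cases hki : k = i.castSucc
    · subst hki
      change IsCoherent (g i.castSucc : X.Modules)
      rw [hgi]
      exact isCoherent_kernelAt hF (h𝓕.coherent _) h0
    · change IsCoherent (g k : X.Modules)
      rw [hgne k hki]
      exact h𝓕.coherent k
  -- The only pair whose order is reversed is (q, p), and it would require the closure of q to lie
  -- in that of p.
  · refine swap_lt_swap hji (hr.symm_lt_symm he hab) ?_
    rintro ⟨ha, hb⟩
    rw [Equiv.symm_apply_eq] at ha hb
    rw [ha, hb, hei, hej] at hab
    exact hpq hab.subset
  · simpa only [Equiv.symm_apply_apply] using hkl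
  · rw [Equiv.trans_apply]
    by_cases hki : k = i
    · rw [hki, hi, Equiv.swap_apply_left, hej]
    · by_cases hkj : k = j
      · rw [hkj, hj, Equiv.swap_apply_right, hei]
      · rw [hk k hki hkj, Equiv.swap_apply_of_ne_of_ne hki hkj]
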